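/- Let $\mu\subseteq\lambda$ be partitions such that $\lambda/\mu$ is a ribbon: the skew diagram $\lambda/\mu$ (the cells of the Young diagram of $\lambda$ that are not in that of $\mu$) is nonempty, it is connected in the sense that $\mu_i<\lambda_{i+1}$ whenever $\mu_i\neq 0$, and it contains no $2\times 2$ block of cells. Assume $\mu_1=s$ and $\lambda_1=s+1$. For a cell $c$ of $\lambda$, let $h(c)$ be its hook length in $\lambda$, that is, the number of cells of $\lambda$ that lie in the row of $c$ weakly to the right of $c$ or in the column of $c$ strictly below $c$. Let $c_{i,j}$ be the cell in row $i$ and column $j$, put $\alpha_i=h(c_{1,i})-1$ for $1\le i\le s+1$, and let $m=\alpha_1$. The content of $c_{i,j}$ is $j-i$, and cells are partially ordered by $c_{i,j}\le c_{i',j'}$ if $i\le i'$ and $j\le j'$. An excited diagram of type $\lambda/\mu$ is a set $D$ of cells of $\lambda$ for which there is a content-preserving bijection $\eta$ from the set of cells of $\mu$ onto $D$ such that, for every integer $k$, the restriction of $\eta$ to the cells of $\mu$ with content $k$ or $k+1$ is order-preserving. The excitation factor of $\lambda/\mu$ is the polynomial $$E(t)=\sum_{D}\Bigl(\prod_{c_{i,j}\in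 D,\ i\ge 2}h(c_{i,j})\Bigr)\Bigl(\prod_{c_{1,j}\in D}(t+\alpha_j)\Bigr),$$ where $D$ runs over all excited diagrams of type $\lambda/\mu$. If $z$ is a complex number with $E(z)=0$, then $|z+m|\le m$. -/

import Mathlib

/- Conventions: cells are pairs `(row, column)` of natural numbers, with rows and columns counted
from `0`, as in `YoungDiagram`; so the cell `c_{i,j}` of the usual `1`-based notation is
`(i - 1, j - 1)`, and `lam.rowLen i` is the part `λ_{i+1}` of the partition. -/

namespace RibbonRoots

/-- The hook length of the cell `c` in the Young diagram `lam`: the number of cells of `lam` that lie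
in the same row weakly to the right of `c`, or in the same column strictly below `c`. -/
def hookLength (lam : YoungDiagram) (c : ℕ × ℕ) : ℕ :=
  (lam.cells.filter fun d => (d.1 = c.1 ∧ c.2 ≤ d.2) ∨ (d.2 = c.2 ∧ c.1 < d.1)).card

/-- The content `column - row` of a cell. -/
def content (c : ℕ × ℕ) : ℤ := (c.2 : ℤ) - (c.1 : ℤ)

/-- The skew shape `lam/mu` is a ribbon: a nonempty connected skew diagram that contains no
`2 × 2` block of cells. -/
structure IsRibbon (lam mu : YoungDiagram) : Prop where
  /-- `mu` is contained in `lam`. -/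
  le : mu ≤ lam
  /-- The skew diagram has at least one cell. -/
  nonempty : (lam.cells \ mu.cells).Nonempty
  /-- Connectedness of the skew shape: `mu_i < lam_{i+1}` for every nonzero part `mu_i`. -/
  connected : ∀ i : ℕ, mu.rowLen i ≠ 0 → mu.rowLen i < lam.rowLen (i + 1)
  /-- There is no `2 × 2` block. -/
  no_block : ∀ i j : ℕ,
    ¬ (({(i, j), (i, j + 1), (i + 1, j), (i + 1, j + 1)} : Finset (ℕ × ℕ)) ⊆
        lam.cells \ mu.cells)

/-- `D` is an excited diagram of type `lam/mu`: a set of cells of `lam` such that there is a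
content-preserving bijection `η` from the cells of `mu` onto `D` whose restriction to any two
neighbouring diagonals (contents `k` and `k + 1`) preserves the "weakly northwest" order
(which is the componentwise order of `ℕ × ℕ`). -/
def IsExcitedDiagram (lam mu : YoungDiagram) (D : Finset (ℕ × ℕ)) : Prop :=
  D ⊆ lam.cells ∧
  ∃ η : ℕ × ℕ → ℕ × ℕ,
    Set.BijOn η (mu.cells : Set (ℕ × ℕ)) (D : Set (ℕ × ℕ)) ∧
    (∀ c ∈ mu.cells, content (η c) = content c) ∧
    (∀ k : ℤ, MonotoneOn η
      {c : ℕ × ℕ | c ∈ mu.cells ∧ (content c = k ∨ content c = k + 1)})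

open Classical in
/-- The finite set of all excited diagrams of type `lam/mu`. -/
noncomputable def excitedDiagrams (lam mu : YoungDiagram) : Finset (Finset (ℕ × ℕ)) :=
  lam.cells.powerset.filter fun D => IsExcitedDiagram lam mu D

/-- The hook length of the cell of `lam` in the first row and column `j` (counted from `0`),
minus one: this is `α_{j+1}`. -/
def alpha (lam : YoungDiagram) (j : ℕ) : ℕ := hookLength lam (0, j) - 1

/-- The excitation factor `E(t)`, as a polynomial in `t`.  Let `lam^(t)` be `lam` with the first
part replaced by `lam_1 + t - 1`.  It has the same excited diagrams relative to `mu` and the same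
hook lengths below the first row as `lam`, and the hook lengths `t + α_j` in the first `lam_1`
columns of the first row. `E(t)` is the sum over all excited diagrams of the product of
these hook lengths. -/
noncomputable def excitationFactor (lam mu : YoungDiagram) : Polynomial ℂ :=
  ∑ D ∈ excitedDiagrams lam mu,
    (∏ c ∈ D.filter (fun c => c.1 ≠ 0), Polynomial.C (hookLength lam c : ℂ)) *
    (∏ c ∈ D.filter (fun c => c.1 = 0), (Polynomial.X + Polynomial.C (alpha lam c.2 : ℂ)))

end RibbonRoots

namespace RibbonRoots

/-! ### A root bound for expansions in a Newton basis -/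

/-! Since `lam/mu` is a ribbon, each cell of `mu` can move down its diagonal at most once, and the
unmoved cells form a lower set `K`. Grouping by the size `j` of the first row of `K` gives `E(t) = ∑
W_j ∏_{i<j} (t + α_i)` with columns counted from `0`. Adding the next first-row cell to `K` loses
the factor `h(1, j+1)`, which is `α_{j+1}` because the first two rows of `lam` agree; hence `W_j ≤
α_{j+1} W_{j+1}` (`rowWeight_le`). An Eneström–Kakeya argument in this Newton basis
(`newton_sum_ne_zero`) excludes roots outside all discs `|t + α_i| ≤ α_i`, and these lie in the disc
for `m = α_0`. -/

lemma norm_mul_newton_sum_sub_le (W a : ℕ → ℝ) (t : ℂ) (hW : ∀ j, 0 ≤ W j) (n : ℕ)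
    (ha : ∀ i ≤ n, 0 ≤ a i) (hWa : ∀ j < n, W j ≤ a (j + 1) * W (j + 1))
    (hta : ∀ i ≤ n, a i < ‖t + a i‖) :
    ‖t * ∑ j ∈ Finset.range (n + 1), (W j : ℂ) * ∏ i ∈ Finset.range j, (t + a i) -
        W n * ∏ i ∈ Finset.range (n + 1), (t + a i)‖ ≤
      a n * W n * ‖∏ i ∈ Finset.range n, (t + (a i : ℂ))‖ := by
  induction n with
  | zero =>
    have h : t * ∑ j ∈ Finset.range (0 + 1), (W j : ℂ) * ∏ i ∈ Finset.range j, (t + a i) -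
        W 0 * ∏ i ∈ Finset.range (0 + 1), (t + a i) = -((a 0 * W 0 : ℝ) : ℂ) := by
      simp; ring
    rw [h, norm_neg, Complex.norm_real, Real.norm_of_nonneg (mul_nonneg (ha 0 le_rfl) (hW 0))]
    simp
  | succ n ih =>
    have ih := ih (fun i hi => ha i (by omega)) (fun j hj => hWa j (by omega))
      (fun i hi => hta i (by omega))
    have hc := hWa n (by omega)
    rw [Finset.sum_range_succ, Finset.prod_range_succ _ (n + 1)]
    set S := ∑ j ∈ Finset.range (n + 1), (W j : ℂ) * ∏ i ∈ Finset.range j, (t + (a i : ℂ))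
    set P := ∏ i ∈ Finset.range (n + 1), (t + (a i : ℂ)) with hP
    -- Multiplication by `t` is rewritten as `t = (t + a (n + 1)) - a (n + 1)`, as in multiplying by
    -- `1 - x` for Eneström–Kakeya; `hWa` makes the correction coefficient nonnegative.
    have h : t * (S + W (n + 1) * P) - W (n + 1) * (P * (t + a (n + 1))) =
        (t * S - W n * P) - ((a (n + 1) * W (n + 1) - W n : ℝ) : ℂ) * P := by
      push_cast; ring
    have hn : a n * W n * ‖∏ i ∈ Finset.range n, (t + (a i : ℂ))‖ ≤ W n * ‖P‖ := by
      rw [hP, Finset.prod_range_succ, norm_mul]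
      have h1 := mul_le_mul_of_nonneg_left (hta n (by omega)).le
        (mul_nonneg (hW n) (norm_nonneg (∏ i ∈ Finset.range n, (t + (a i : ℂ)))))
      linarith
    rw [h]
    refine (norm_sub_le _ _).trans ?_
    rw [norm_mul, Complex.norm_real, Real.norm_of_nonneg (sub_nonneg.2 hc)]
    linarith

/-- At a zero the preceding estimate, after cancelling the positive common factors, would give `‖t +
a n‖ ≤ a n`. -/
lemma newton_sum_ne_zero (W a : ℕ → ℝ) (t : ℂ) (hW : ∀ j, 0 ≤ W j) (n : ℕ)
    (ha : ∀ i ≤ n, 0 ≤ a i) (hWa : ∀ j < n, W j ≤ a (j + 1) * W (j + 1))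
    (hta : ∀ i ≤ n, a i < ‖t + a i‖) (hn : 0 < W n) :
    ∑ j ∈ Finset.range (n + 1), (W j : ℂ) * ∏ i ∈ Finset.range j, (t + a i) ≠ 0 := by
  intro h0
  have h := norm_mul_newton_sum_sub_le W a t hW n ha hWa hta
  rw [h0, mul_zero, zero_sub, norm_neg, norm_mul, Complex.norm_real,
    Real.norm_of_nonneg (hW n), Finset.prod_range_succ, norm_mul] at h
  have hP : 0 < ‖∏ i ∈ Finset.range n, (t + (a i : ℂ))‖ := by
    rw [norm_prod]
    refine Finset.prod_pos fun i hi => ?_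
    have := Finset.mem_range.1 hi
    exact (ha i this.le).trans_lt (hta i this.le)
  nlinarith [mul_lt_mul_of_pos_left (hta n le_rfl) (mul_pos hn hP)]

/-! ### Hook lengths -/

lemma hookLength_eq (lam : YoungDiagram) (i j : ℕ) :
    hookLength lam (i, j) = (lam.rowLen i - j) + (lam.colLen j - (i + 1)) := by
  classical
  have h : (lam.cells.filter fun d => (d.1 = i ∧ j ≤ d.2) ∨ (d.2 = j ∧ i < d.1)) =
      (Finset.Ico j (lam.rowLen i)).image (fun b => (i, b)) ∪
        (Finset.Ico (i + 1) (lam.colLen j)).image (fun b => (b, j)) := by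
    ext ⟨x, y⟩
    simp only [Finset.mem_filter, YoungDiagram.mem_cells, Finset.mem_union, Finset.mem_image,
      Finset.mem_Ico, Prod.mk.injEq]
    constructor
    · rintro ⟨hm, ⟨rfl, h⟩ | ⟨rfl, h⟩⟩
      · exact Or.inl ⟨y, ⟨h, YoungDiagram.mem_iff_lt_rowLen.1 hm⟩, rfl, rfl⟩
      · exact Or.inr ⟨x, ⟨h, YoungDiagram.mem_iff_lt_colLen.1 hm⟩, rfl, rfl⟩
    · rintro (⟨b, ⟨h1, h2⟩, rfl, rfl⟩ | ⟨b, ⟨h1, h2⟩, rfl, rfl⟩)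
      · exact ⟨YoungDiagram.mem_iff_lt_rowLen.2 h2, Or.inl ⟨rfl, h1⟩⟩
      · exact ⟨YoungDiagram.mem_iff_lt_colLen.2 h2, Or.inr ⟨rfl, h1⟩⟩
  unfold hookLength
  rw [h, Finset.card_union_of_disjoint, Finset.card_image_of_injective,
    Finset.card_image_of_injective, Nat.card_Ico, Nat.card_Ico]
  · intro a b hab; simpa using hab
  · intro a b hab; simpa using hab
  · rw [Finset.disjoint_left]
    rintro ⟨x, y⟩ h1 h2
    simp only [Finset.mem_image, Finset.mem_Ico, Prod.mk.injEq] at h1 h2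
    obtain ⟨_, _, rfl, -⟩ := h1
    obtain ⟨_, h, rfl, -⟩ := h2
    omega

lemma alpha_anti (lam : YoungDiagram) : Antitone (alpha lam) := by
  intro i j hij
  have := lam.colLen_anti i j hij
  simp only [alpha, hookLength_eq]
  omega

lemma alpha_eq_hookLength (lam : YoungDiagram) {j : ℕ} (h : lam.rowLen 1 = lam.rowLen 0)
    (hj : j < lam.rowLen 0) : alpha lam j = hookLength lam (1, j) := by
  have h1 : (1, j) ∈ lam := YoungDiagram.mem_iff_lt_rowLen.2 (h ▸ hj)
  have := YoungDiagram.mem_iff_lt_colLen.1 h1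
  simp only [alpha, hookLength_eq]
  omega

/-! ### Excited diagrams of a ribbon and lower sets -/

/-- Connectedness gives one direction. For the other, a cell outside `mu` whose diagonal successor
is in `lam` would start a `2 × 2` block. -/
lemma IsRibbon.mem_iff {lam mu : YoungDiagram} (h : IsRibbon lam mu) (i j : ℕ) :
    (i, j) ∈ mu ↔ (i + 1, j + 1) ∈ lam := by
  constructor
  · intro hm
    have h1 := YoungDiagram.mem_iff_lt_rowLen.1 hm
    have h2 := h.connected i (by omega)
    exact YoungDiagram.mem_iff_lt_rowLen.2 (by omega)
  · intro hm
    by_contra hn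
    refine h.no_block i j fun c hc => ?_
    simp only [Finset.mem_insert, Finset.mem_singleton] at hc
    simp only [Finset.mem_sdiff, YoungDiagram.mem_cells]
    rcases hc with rfl | rfl | rfl | rfl <;>
      exact ⟨lam.up_left_mem (by omega) (by omega) hm,
        fun h' => hn (mu.up_left_mem (by omega) (by omega) h')⟩

/-- The cell diagonally below a given cell. -/
def diagSucc (c : ℕ × ℕ) : ℕ × ℕ := (c.1 + 1, c.2 + 1)

lemma diagSucc_injective : Function.Injective diagSucc := by
  rintro ⟨a, b⟩ ⟨c, d⟩ h
  simpa [diagSucc] using h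

lemma le_diagSucc (c : ℕ × ℕ) : c ≤ diagSucc c := ⟨Nat.le_succ _, Nat.le_succ _⟩

open Classical in
/-- The lower sets contained in `mu`. -/
noncomputable def lowerSubsets (mu : YoungDiagram) : Finset (Finset (ℕ × ℕ)) :=
  mu.cells.powerset.filter fun K => IsLowerSet (K : Set (ℕ × ℕ))

lemma mem_lowerSubsets {mu : YoungDiagram} {K : Finset (ℕ × ℕ)} :
    K ∈ lowerSubsets mu ↔ K ⊆ mu.cells ∧ IsLowerSet (K : Set (ℕ × ℕ)) := by
  simp [lowerSubsets]

/-- Move all the cells of `mu` outside of `K` diagonally down by one step. -/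
noncomputable def excite (mu : YoungDiagram) (K : Finset (ℕ × ℕ)) : Finset (ℕ × ℕ) :=
  K ∪ (mu.cells \ K).image diagSucc

lemma mem_excite {mu : YoungDiagram} {K : Finset (ℕ × ℕ)} {c : ℕ × ℕ} :
    c ∈ excite mu K ↔ c ∈ K ∨ ∃ b, (b ∈ mu ∧ b ∉ K) ∧ diagSucc b = c := by
  simp only [excite, Finset.mem_union, Finset.mem_image, Finset.mem_sdiff, YoungDiagram.mem_cells]

/-- Induction on rows: a cell of `K` that arose in `excite mu L` by a shift would have its
predecessor in `K`, hence in `L`, so unshifted. -/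
lemma subset_of_excite_eq {mu : YoungDiagram} {K L : Finset (ℕ × ℕ)}
    (hK : IsLowerSet (K : Set (ℕ × ℕ))) (h : excite mu K = excite mu L) : K ⊆ L := by
  have key : ∀ i j, (i, j) ∈ K → (i, j) ∈ L := by
    intro i
    induction i with
    | zero =>
      intro j hj
      have h1 : (0, j) ∈ excite mu L := h ▸ mem_excite.2 (Or.inl hj)
      rcases mem_excite.1 h1 with h1 | ⟨b, -, hb⟩
      · exact h1
      · simp [diagSucc] at hb
    | succ i ih =>
      intro j hj
      have h1 : (i + 1, j) ∈ excite mu L := h ▸ mem_excite.2 (Or.inl hj)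
      rcases mem_excite.1 h1 with h1 | ⟨⟨x, y⟩, ⟨-, hb⟩, hbj⟩
      · exact h1
      · obtain ⟨rfl, rfl⟩ : x = i ∧ y + 1 = j := by simpa [diagSucc] using hbj
        exact absurd (ih y (hK (le_diagSucc (x, y)) hj)) hb
  rintro ⟨i, j⟩
  exact key i j

lemma excite_injOn (mu : YoungDiagram) :
    Set.InjOn (excite mu) (lowerSubsets mu : Set (Finset (ℕ × ℕ))) := by
  intro K hK L hL h
  exact (subset_of_excite_eq (mem_lowerSubsets.1 hK).2 h).antisymm
    (subset_of_excite_eq (mem_lowerSubsets.1 hL).2 h.symm)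

lemma disjoint_image_diagSucc {mu : YoungDiagram} {K : Finset (ℕ × ℕ)}
    (hK : IsLowerSet (K : Set (ℕ × ℕ))) : Disjoint K ((mu.cells \ K).image diagSucc) := by
  rw [Finset.disjoint_left]
  intro c hc h
  obtain ⟨b, hb, rfl⟩ := Finset.mem_image.1 h
  exact (Finset.mem_sdiff.1 hb).2 (hK (le_diagSucc b) hc)

lemma isExcitedDiagram_excite {lam mu : YoungDiagram} (h : IsRibbon lam mu)
    {K : Finset (ℕ × ℕ)} (hK : K ∈ lowerSubsets mu) : IsExcitedDiagram lam mu (excite mu K) := by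
  classical
  obtain ⟨hKmu, hlow⟩ := mem_lowerSubsets.1 hK
  have hlow' : ∀ c d, c ≤ d → d ∈ K → c ∈ K := fun c d hcd hd => hlow hcd hd
  refine ⟨fun c hc => ?_, fun c => if c ∈ K then c else diagSucc c, ⟨?_, ?_, ?_⟩, ?_, ?_⟩
  · rcases mem_excite.1 hc with hc | ⟨b, ⟨hb, -⟩, rfl⟩
    · exact h.le (hKmu hc)
    · exact (h.mem_iff b.1 b.2).1 hb
  · intro c hc
    by_cases hcK : c ∈ K
    · simpa [hcK] using mem_excite.2 (Or.inl hcK)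
    · simpa [hcK] using mem_excite.2 (Or.inr ⟨c, ⟨hc, hcK⟩, rfl⟩)
  · intro c hc d hd hcd
    by_cases hcK : c ∈ K <;> by_cases hdK : d ∈ K <;> simp only [hcK, hdK, if_true, if_false] at hcd
    · exact hcd
    · exact absurd (hlow' _ _ (le_diagSucc d) (hcd ▸ hcK)) hdK
    · exact absurd (hlow' _ _ (le_diagSucc c) (hcd ▸ hdK)) hcK
    · exact diagSucc_injective hcd
  · intro c hc
    rcases mem_excite.1 hc with hc | ⟨b, ⟨hb, hbK⟩, rfl⟩
    · exact ⟨c, hKmu hc, by simp [hc]⟩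
    · exact ⟨b, hb, by simp [hbK]⟩
  · intro c _
    by_cases hcK : c ∈ K
    · simp [hcK]
    · simp [hcK, content, diagSucc]
  · intro k c _ d _ hcd
    by_cases hcK : c ∈ K <;> by_cases hdK : d ∈ K <;> simp only [hcK, hdK, if_true, if_false]
    · exact hcd
    · exact hcd.trans (le_diagSucc d)
    · exact absurd (hlow' _ _ hcd hdK) hcK
    · exact ⟨Nat.succ_le_succ hcd.1, Nat.succ_le_succ hcd.2⟩

/-- Along a diagonal `η` strictly increases the row, so no cell moves up. If a cell moved two or
more steps, its image in `lam` would put its diagonal successor in `mu`, and that cell would also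
move at least two steps, endlessly. -/
lemma eq_or_eq_diagSucc {lam mu : YoungDiagram} (h : IsRibbon lam mu) {η : ℕ × ℕ → ℕ × ℕ}
    (hmaps : ∀ c ∈ mu, η c ∈ lam) (hinj : Set.InjOn η (mu.cells : Set (ℕ × ℕ)))
    (hcont : ∀ c ∈ mu.cells, content (η c) = content c)
    (hmono : ∀ k : ℤ, MonotoneOn η
      {c : ℕ × ℕ | c ∈ mu.cells ∧ (content c = k ∨ content c = k + 1)})
    {c : ℕ × ℕ} (hc : c ∈ mu) : η c = c ∨ η c = diagSucc c := by
  have hcon : ∀ i j, (i, j) ∈ mu → (η (i, j)).2 + i = (η (i, j)).1 + j := by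
    intro i j hm
    have := hcont (i, j) hm
    simp only [content] at this
    omega
  have hstep : ∀ i j, (i + 1, j + 1) ∈ mu → (η (i, j)).1 < (η (i + 1, j + 1)).1 := by
    intro i j hm
    have hm' : (i, j) ∈ mu := mu.up_left_mem (by omega) (by omega) hm
    have hle : η (i, j) ≤ η (i + 1, j + 1) :=
      hmono (content (i, j)) ⟨hm', Or.inl rfl⟩ ⟨hm, Or.inl (by simp [content])⟩
        ⟨Nat.le_succ _, Nat.le_succ _⟩
    refine lt_of_le_of_ne hle.1 fun heq => ?_
    have h1 := hcon _ _ hm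
    have h2 := hcon _ _ hm'
    have := hinj hm' hm (Prod.ext heq (by omega))
    simp at this
  have hlow : ∀ i j, (i, j) ∈ mu → i ≤ (η (i, j)).1 := by
    intro i
    induction i with
    | zero => intro j _; exact Nat.zero_le _
    | succ i ih =>
      intro j hm
      cases j with
      | zero => have := hcon _ _ hm; omega
      | succ j =>
        have := ih j (mu.up_left_mem (by omega) (by omega) hm)
        have := hstep i j hm
        omega
  obtain ⟨i, j⟩ := c
  have hup : (η (i, j)).1 ≤ i + 1 := by
    by_contra! hlt
    have key : ∀ n, (i + n, j + n) ∈ mu ∧ i + n + 1 < (η (i + n, j + n)).1 := by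
      intro n
      induction n with
      | zero => exact ⟨hc, hlt⟩
      | succ n ih =>
        obtain ⟨ih1, ih2⟩ := ih
        have h1 := hcon _ _ ih1
        have h2 : (i + n + 1, j + n + 1) ∈ mu :=
          (h.mem_iff _ _).2 (lam.up_left_mem (by omega) (by omega) (hmaps _ ih1))
        have h3 := hstep _ _ h2
        exact ⟨h2, by simp only [← add_assoc]; omega⟩
    have h1 := YoungDiagram.mem_iff_lt_rowLen.1 (key (mu.rowLen 0)).1
    have h2 := mu.rowLen_anti 0 (i + mu.rowLen 0) (Nat.zero_le _)
    omega
  have h1 := hlow i j hc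
  have h2 := hcon i j hc
  rcases (show (η (i, j)).1 = i ∨ (η (i, j)).1 = i + 1 by omega) with h3 | h3
  · exact Or.inl (Prod.ext h3 (by simp only; omega))
  · exact Or.inr (Prod.ext h3 (by simp only [diagSucc]; omega))

lemma isLowerSet_of_steps {S : Set (ℕ × ℕ)} (h1 : ∀ i j, (i + 1, j) ∈ S → (i, j) ∈ S)
    (h2 : ∀ i j, (i, j + 1) ∈ S → (i, j) ∈ S) : IsLowerSet S := by
  have h1' : ∀ n i j, (i + n, j) ∈ S → (i, j) ∈ S := by
    intro n
    induction n with
    | zero => exact fun _ _ h => h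
    | succ n ih => exact fun i j h => ih i j (h1 _ _ h)
  have h2' : ∀ n i j, (i, j + n) ∈ S → (i, j) ∈ S := by
    intro n
    induction n with
    | zero => exact fun _ _ h => h
    | succ n ih => exact fun i j h => ih i j (h2 _ _ h)
  rintro ⟨a, b⟩ ⟨c, d⟩ ⟨hc, hd⟩ hm
  simp only at hc hd
  obtain ⟨m, rfl⟩ := Nat.exists_eq_add_of_le hc
  obtain ⟨n, rfl⟩ := Nat.exists_eq_add_of_le hd
  exact h1' _ _ _ (h2' _ _ _ hm)

/-- `K` is the set of fixed cells of `η`. It is a lower set because shifting the upper or left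
neighbour of a fixed cell would break monotonicity on two adjacent diagonals. -/
lemma exists_excite_of_isExcitedDiagram {lam mu : YoungDiagram} (h : IsRibbon lam mu)
    {D : Finset (ℕ × ℕ)} (hD : IsExcitedDiagram lam mu D) :
    ∃ K ∈ lowerSubsets mu, excite mu K = D := by
  classical
  obtain ⟨hDlam, η, ⟨hmaps, hinj, hsurj⟩, hcont, hmono⟩ := hD
  have hη : ∀ c ∈ mu, η c = c ∨ η c = diagSucc c := fun c hc =>
    eq_or_eq_diagSucc h (fun c hc => hDlam (hmaps hc)) hinj hcont hmono hc
  have hmem : ∀ c, c ∈ mu.cells.filter (fun c => η c = c) ↔ c ∈ mu ∧ η c = c := by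
    intro c; rw [Finset.mem_filter, YoungDiagram.mem_cells]
  refine ⟨mu.cells.filter fun c => η c = c, mem_lowerSubsets.2
    ⟨Finset.filter_subset _ _, isLowerSet_of_steps ?_ ?_⟩, ?_⟩
  · intro i j hij
    rw [Finset.mem_coe, hmem] at hij ⊢
    have hm : (i, j) ∈ mu := mu.up_left_mem (by omega) le_rfl hij.1
    refine ⟨hm, (hη _ hm).resolve_right fun he => ?_⟩
    have hle := hmono (content (i + 1, j)) ⟨hm, Or.inr (by simp [content]; ring)⟩ ⟨hij.1, Or.inl rfl⟩
      ⟨Nat.le_succ _, le_rfl⟩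
    rw [he, hij.2] at hle
    exact absurd hle.2 (by simp [diagSucc])
  · intro i j hij
    rw [Finset.mem_coe, hmem] at hij ⊢
    have hm : (i, j) ∈ mu := mu.up_left_mem le_rfl (by omega) hij.1
    refine ⟨hm, (hη _ hm).resolve_right fun he => ?_⟩
    have hle := hmono (content (i, j)) ⟨hm, Or.inl rfl⟩
      ⟨hij.1, Or.inr (by simp [content]; ring)⟩ ⟨le_rfl, Nat.le_succ _⟩
    rw [he, hij.2] at hle
    exact absurd hle.1 (by simp [diagSucc])
  · ext c
    simp only [mem_excite, hmem]
    constructor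
    · rintro (⟨hc, he⟩ | ⟨b, ⟨hb, hbn⟩, rfl⟩)
      · exact he ▸ hmaps hc
      · rw [← (hη b hb).resolve_left fun he => hbn ⟨hb, he⟩]
        exact hmaps hb
    · intro hc
      obtain ⟨b, hb, rfl⟩ := hsurj hc
      rcases hη b hb with he | he
      · exact Or.inl (by rw [he]; exact ⟨hb, he⟩)
      · refine Or.inr ⟨b, ⟨hb, fun hn => ?_⟩, he.symm⟩
        have := congrArg Prod.fst (he.symm.trans hn.2)
        simp [diagSucc] at this

lemma excitedDiagrams_eq_image {lam mu : YoungDiagram} (h : IsRibbon lam mu) :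
    excitedDiagrams lam mu = (lowerSubsets mu).image (excite mu) := by
  ext D
  simp only [excitedDiagrams, Finset.mem_filter, Finset.mem_powerset, Finset.mem_image]
  constructor
  · rintro ⟨-, hD⟩
    exact exists_excite_of_isExcitedDiagram h hD
  · rintro ⟨K, hK, rfl⟩
    have := isExcitedDiagram_excite h hK
    exact ⟨this.1, this⟩

/-! ### The expansion of the excitation factor -/

/-- The number of cells of `K` in the first row. -/
def firstRowCard (K : Finset (ℕ × ℕ)) : ℕ := (K.filter fun c => c.1 = 0).card

/-- The product of the hook lengths of the cells of `excite mu K` below the first row. -/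
noncomputable def lowerWeight (lam mu : YoungDiagram) (K : Finset (ℕ × ℕ)) : ℕ :=
  (∏ c ∈ K.filter (fun c => c.1 ≠ 0), hookLength lam c) *
    ∏ c ∈ mu.cells \ K, hookLength lam (diagSucc c)

/-- The total weight of the lower sets with `j` cells in the first row. -/
noncomputable def rowWeight (lam mu : YoungDiagram) (j : ℕ) : ℕ :=
  ∑ K ∈ (lowerSubsets mu).filter (fun K => firstRowCard K = j), lowerWeight lam mu K

lemma filter_firstRow {K : Finset (ℕ × ℕ)} (hK : IsLowerSet (K : Set (ℕ × ℕ))) :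
    K.filter (fun c => c.1 = 0) = (Finset.range (firstRowCard K)).image (fun j => (0, j)) := by
  have h : K.filter (fun c => c.1 = 0) = (⟨K, hK⟩ : YoungDiagram).row 0 := rfl
  rw [firstRowCard, h, ← YoungDiagram.rowLen_eq_card, YoungDiagram.row_eq_prod]
  ext ⟨a, b⟩
  simp [and_comm, eq_comm]

lemma mem_firstRow_iff {K : Finset (ℕ × ℕ)} (hK : IsLowerSet (K : Set (ℕ × ℕ))) (j : ℕ) :
    (0, j) ∈ K ↔ j < firstRowCard K := by
  have : (0, j) ∈ K.filter (fun c => c.1 = 0) ↔ j < firstRowCard K := by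
    rw [filter_firstRow hK]; simp
  simpa using this

lemma eval_excitationFactor {lam mu : YoungDiagram} (h : IsRibbon lam mu) (z : ℂ) :
    (excitationFactor lam mu).eval z = ∑ K ∈ lowerSubsets mu,
      (lowerWeight lam mu K : ℂ) * ∏ j ∈ Finset.range (firstRowCard K), (z + alpha lam j) := by
  rw [excitationFactor, excitedDiagrams_eq_image h, Finset.sum_image (excite_injOn mu),
    Polynomial.eval_finsetSum]
  refine Finset.sum_congr rfl fun K hK => ?_
  have hlow := (mem_lowerSubsets.1 hK).2
  have h0 : (excite mu K).filter (fun c => c.1 = 0) = K.filter (fun c => c.1 = 0) := by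
    ext c
    simp only [Finset.mem_filter, mem_excite]
    constructor
    · rintro ⟨hc | ⟨b, -, rfl⟩, h0⟩
      · exact ⟨hc, h0⟩
      · simp [diagSucc] at h0
    · exact fun hc => ⟨Or.inl hc.1, hc.2⟩
  have h1 : (excite mu K).filter (fun c => c.1 ≠ 0) =
      K.filter (fun c => c.1 ≠ 0) ∪ (mu.cells \ K).image diagSucc := by
    rw [excite, Finset.filter_union]
    congr 1
    refine Finset.filter_true_of_mem fun c hc => ?_
    obtain ⟨b, -, rfl⟩ := Finset.mem_image.1 hc
    exact Nat.succ_ne_zero _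
  rw [h0, h1, Finset.prod_union ((disjoint_image_diagSucc hlow).mono_left
      (Finset.filter_subset _ _)), Finset.prod_image diagSucc_injective.injOn,
    filter_firstRow hlow, Finset.prod_image (by intro a _ b _ hab; simpa using hab)]
  simp [lowerWeight, Polynomial.eval_prod]

lemma firstRowCard_le {mu : YoungDiagram} {K : Finset (ℕ × ℕ)} (hK : K ⊆ mu.cells) :
    firstRowCard K ≤ mu.rowLen 0 := by
  rw [YoungDiagram.rowLen_eq_card]
  exact Finset.card_le_card (Finset.filter_subset_filter _ hK)

lemma eval_excitationFactor_eq_newton_sum {lam mu : YoungDiagram} (h : IsRibbon lam mu) (z : ℂ) :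
    (excitationFactor lam mu).eval z = ∑ j ∈ Finset.range (mu.rowLen 0 + 1),
      (rowWeight lam mu j : ℂ) * ∏ i ∈ Finset.range j, (z + alpha lam i) := by
  rw [eval_excitationFactor h, ← Finset.sum_fiberwise_of_maps_to
    (t := Finset.range (mu.rowLen 0 + 1)) (g := firstRowCard)]
  · refine Finset.sum_congr rfl fun j _ => ?_
    rw [rowWeight, Nat.cast_sum, Finset.sum_mul]
    refine Finset.sum_congr rfl fun K hK => ?_
    rw [(Finset.mem_filter.1 hK).2]
  · intro K hK
    exact Finset.mem_range.2 (Nat.lt_succ_of_le (firstRowCard_le (mem_lowerSubsets.1 hK).1))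

/-! ### Comparison of consecutive coefficients -/

lemma insert_firstRow_mem_lowerSubsets {mu : YoungDiagram} {K : Finset (ℕ × ℕ)}
    (hK : K ∈ lowerSubsets mu) (hj : firstRowCard K < mu.rowLen 0) :
    insert (0, firstRowCard K) K ∈ lowerSubsets mu := by
  obtain ⟨hsub, hlow⟩ := mem_lowerSubsets.1 hK
  refine mem_lowerSubsets.2 ⟨Finset.insert_subset (YoungDiagram.mem_iff_lt_rowLen.2 hj) hsub, ?_⟩
  rintro ⟨a, b⟩ ⟨c, d⟩ hle hm
  simp only [Finset.coe_insert, Set.mem_insert_iff, Finset.mem_coe] at hm ⊢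
  rcases hm with heq | hm
  · obtain ⟨rfl, rfl⟩ := Prod.mk.inj heq
    obtain ⟨h1, h2⟩ := hle
    simp only at h1 h2
    obtain rfl : c = 0 := by omega
    rcases h2.eq_or_lt with h2 | h2
    · exact Or.inl (by rw [h2])
    · exact Or.inr ((mem_firstRow_iff hlow _).2 h2)
  · exact Or.inr (hlow hle hm)

lemma firstRowCard_insert {K : Finset (ℕ × ℕ)} (hlow : IsLowerSet (K : Set (ℕ × ℕ))) :
    firstRowCard (insert (0, firstRowCard K) K) = firstRowCard K + 1 := by
  have hn : (0, firstRowCard K) ∉ K := fun h => lt_irrefl _ ((mem_firstRow_iff hlow _).1 h)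
  conv_lhs => rw [firstRowCard]
  rw [Finset.filter_insert, if_pos rfl, Finset.card_insert_of_notMem (by simp [hn])]
  rfl

lemma lowerWeight_insert {lam mu : YoungDiagram} {K : Finset (ℕ × ℕ)}
    (hK : K ∈ lowerSubsets mu) (hj : firstRowCard K < mu.rowLen 0) :
    lowerWeight lam mu K = hookLength lam (1, firstRowCard K + 1) *
      lowerWeight lam mu (insert (0, firstRowCard K) K) := by
  have hlow := (mem_lowerSubsets.1 hK).2
  have hn : (0, firstRowCard K) ∉ K := fun h => lt_irrefl _ ((mem_firstRow_iff hlow _).1 h)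
  have hm : (0, firstRowCard K) ∈ mu.cells \ K :=
    Finset.mem_sdiff.2 ⟨YoungDiagram.mem_iff_lt_rowLen.2 hj, hn⟩
  have he : mu.cells \ insert (0, firstRowCard K) K =
      (mu.cells \ K).erase (0, firstRowCard K) := Finset.sdiff_insert _ _ _
  rw [lowerWeight, lowerWeight, he, Finset.filter_insert, if_neg (by simp),
    ← Finset.mul_prod_erase _ _ hm]
  simp only [diagSucc]
  ring

/-- Insertion of `(0, j)` is injective but need not be onto: a lower set containing `(1, j)` is
missed. The missed terms only enlarge the right side. -/
lemma rowWeight_le (lam mu : YoungDiagram) {j : ℕ} (hj : j < mu.rowLen 0) :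
    rowWeight lam mu j ≤ hookLength lam (1, j + 1) * rowWeight lam mu (j + 1) := by
  have hmem : ∀ K ∈ (lowerSubsets mu).filter (fun K => firstRowCard K = j),
      K ∈ lowerSubsets mu ∧ firstRowCard K = j := fun K hK => Finset.mem_filter.1 hK
  have hn : ∀ K ∈ (lowerSubsets mu).filter (fun K => firstRowCard K = j), (0, j) ∉ K := by
    intro K hK h
    obtain ⟨h1, h2⟩ := hmem K hK
    exact absurd ((mem_firstRow_iff (mem_lowerSubsets.1 h1).2 _).1 h) (by omega)
  have hinj : Set.InjOn (insert (0, j))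
      ((lowerSubsets mu).filter (fun K => firstRowCard K = j) : Set (Finset (ℕ × ℕ))) := by
    intro K hK L hL h
    rw [← Finset.erase_insert (hn K hK), ← Finset.erase_insert (hn L hL)]
    exact congrArg (fun S => S.erase (0, j)) h
  calc rowWeight lam mu j
      = ∑ K ∈ (lowerSubsets mu).filter (fun K => firstRowCard K = j),
          hookLength lam (1, j + 1) * lowerWeight lam mu (insert (0, j) K) := by
        refine Finset.sum_congr rfl fun K hK => ?_
        obtain ⟨h1, rfl⟩ := hmem K hK
        exact lowerWeight_insert h1 hj
    _ = hookLength lam (1, j + 1) * ∑ K ∈ ((lowerSubsets mu).filter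
          (fun K => firstRowCard K = j)).image (insert (0, j)), lowerWeight lam mu K := by
        rw [Finset.sum_image hinj, Finset.mul_sum]
    _ ≤ _ := by
        refine Nat.mul_le_mul_left _ (Finset.sum_le_sum_of_subset fun L hL => ?_)
        obtain ⟨K, hK, rfl⟩ := Finset.mem_image.1 hL
        obtain ⟨h1, rfl⟩ := hmem K hK
        exact Finset.mem_filter.2 ⟨insert_firstRow_mem_lowerSubsets h1 hj,
          firstRowCard_insert (mem_lowerSubsets.1 h1).2⟩

lemma hookLength_pos {lam : YoungDiagram} {c : ℕ × ℕ} (hc : c ∈ lam) : 0 < hookLength lam c :=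
  Finset.card_pos.2 ⟨c, Finset.mem_filter.2 ⟨hc, Or.inl ⟨rfl, le_rfl⟩⟩⟩

lemma rowWeight_rowLen_pos {lam mu : YoungDiagram} (h : mu ≤ lam) :
    0 < rowWeight lam mu (mu.rowLen 0) := by
  have hmem : mu.cells ∈ (lowerSubsets mu).filter (fun K => firstRowCard K = mu.rowLen 0) :=
    Finset.mem_filter.2 ⟨mem_lowerSubsets.2 ⟨subset_rfl, mu.isLowerSet⟩,
      mu.rowLen_eq_card.symm⟩
  refine lt_of_lt_of_le ?_ (Finset.single_le_sum (fun _ _ => Nat.zero_le _) hmem)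
  rw [lowerWeight, Finset.sdiff_self, Finset.prod_empty, mul_one]
  exact Finset.prod_pos fun c hc => hookLength_pos (h (Finset.mem_filter.1 hc).1)

lemma IsRibbon.rowLen_one_eq {lam mu : YoungDiagram} (h : IsRibbon lam mu)
    (hrow : lam.rowLen 0 = mu.rowLen 0 + 1) (h0 : mu.rowLen 0 ≠ 0) :
    lam.rowLen 1 = lam.rowLen 0 := by
  have h1 : mu.rowLen 0 < lam.rowLen 1 := h.connected 0 h0
  have h2 := lam.rowLen_anti 0 1 (by omega)
  omega

end RibbonRoots

theorem theorem4p1 (lam mu : YoungDiagram) (hrib : RibbonRoots.IsRibbon lam mu)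
    (hrow : lam.rowLen 0 = mu.rowLen 0 + 1)
    (m : ℕ) (hm : m = RibbonRoots.alpha lam 0)
    (z : ℂ) (hz : (RibbonRoots.excitationFactor lam mu).eval z = 0) :
    ‖z + (m : ℂ)‖ ≤ (m : ℝ) := by
  by_contra! hlt
  rw [RibbonRoots.eval_excitationFactor_eq_newton_sum hrib] at hz
  refine RibbonRoots.newton_sum_ne_zero (fun j => (RibbonRoots.rowWeight lam mu j : ℝ))
    (fun i => (RibbonRoots.alpha lam i : ℝ)) z (fun _ => Nat.cast_nonneg _) (mu.rowLen 0)
    (fun _ _ => Nat.cast_nonneg _) (fun j hj => ?_) (fun i _ => ?_)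
    (Nat.cast_pos.2 (RibbonRoots.rowWeight_rowLen_pos hrib.le)) (by simpa using hz)
  · rw [RibbonRoots.alpha_eq_hookLength lam (hrib.rowLen_one_eq hrow (by omega)) (by omega)]
    exact_mod_cast RibbonRoots.rowWeight_le lam mu hj
  -- The disc of centre `-α_i` and radius `α_i` lies in the one for `m`, since `α_i ≤ m`.
  · have hle : (RibbonRoots.alpha lam i : ℝ) ≤ m := by
      rw [hm]; exact_mod_cast RibbonRoots.alpha_anti lam (Nat.zero_le i)
    have h1 : z + (m : ℂ) = (z + ((RibbonRoots.alpha lam i : ℝ) : ℂ)) +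
        ((m - RibbonRoots.alpha lam i : ℝ) : ℂ) := by
      push_cast; ring
    have h2 := norm_add_le (z + ((RibbonRoots.alpha lam i : ℝ) : ℂ))
      ((m - RibbonRoots.alpha lam i : ℝ) : ℂ)
    rw [← h1, Complex.norm_real, Real.norm_of_nonneg (sub_nonneg.2 hle)] at h2
    linarith
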